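/- Let $\Bbbk$ be a field and $I$ a set. An $I$-bialgebra is a (coassociative, counital) $\Bbbk$-coalgebra $B$ equipped with an $I$-indexed family of bilinear associative multiplications, all having the same two-sided unit $1\in B$, such that the unit map $\Bbbk\to B$ and all the multiplication maps $B\otimes B\to B$ are coalgebra maps; morphisms of $I$-bialgebras are the coalgebra maps that preserve the unit and all the multiplications. For $J\subseteq I$ let ${}_{(I,J)}\mathrm{Halg}$ be the category of $(I,J)$-Hopf algebras, i.e. the full subcategory of those $I$-bialgebras whose $j$-th bialgebra structure has an antipode for every $j\in J$, and let ${}_{(I,J)}\mathrm{Halg}^{coc}$ be its full subcategory of objects with cocommutative underlying coalgebra. **Proposition.** For sets $J'\subseteq J\subseteq I$ the forgetful functors $${}_{(I,J)}\mathrm{Halg}\longrightarrow {}_{(I,J')}\mathrm{Halg}\qquad\text{and}\qquad {}_{(I,J)}\mathrm{Halg}^{coc}\longrightarrow {}_{(I,J')}\mathrm{Halg}^{coc}$$ (which forget the antipodes indexed by $J\setminus J'$) have left adjoints. -/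

import Mathlib

open CategoryTheory
open scoped TensorProduct

/-- An `I`-bialgebra over the field `k`: a (coassociative, counital) `k`-coalgebra `B` with an
`I`-indexed family of bilinear, associative multiplications sharing one common two-sided unit, such
that the unit map `k → B` and all multiplication maps `B ⊗ B → B` are coalgebra maps. -/
class MultiBialgebra (k : Type*) (I : Type*) (B : Type*)
    [Field k] [AddCommGroup B] [Module k B] extends Coalgebra k B where
  /-- The common unit. -/
  one : B
  /-- The multiplication labelled by `i`. -/
  mul : I → B →ₗ[k] B →ₗ[k] B
  one_mul : ∀ (i : I) (a : B), mul i one a = a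
  mul_one : ∀ (i : I) (a : B), mul i a one = a
  mul_assoc : ∀ (i : I) (a b c : B), mul i (mul i a b) c = mul i a (mul i b c)
  counit_one : counit one = 1
  comul_one : comul one = one ⊗ₜ[k] one
  counit_mul : ∀ (i : I) (a b : B), counit (mul i a b) = counit a * counit b
  /-- `Δ(ab) = Δ(a)Δ(b)`, with the product of `B ⊗ B` taken factorwise. -/
  comul_mul : ∀ (i : I) (a b : B),
    comul (mul i a b) = TensorProduct.map₂ (mul i) (mul i) (comul a) (comul b)

namespace MultiBialgebra

/-- `S` is an antipode for the `i`-th bialgebra structure of `B`: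
`S(b₁) ·ᵢ b₂ = ε(b) 1 = b₁ ·ᵢ S(b₂)` in Sweedler notation. -/
structure IsAntipode {k I B : Type*} [Field k] [AddCommGroup B] [Module k B]
    [MultiBialgebra k I B] (i : I) (S : B →ₗ[k] B) : Prop where
  mul_rTensor_comul : ∀ b : B,
    TensorProduct.lift (mul (k := k) i) (S.rTensor B (Coalgebra.comul b)) =
      (Coalgebra.counit b : k) • one k I
  mul_lTensor_comul : ∀ b : B,
    TensorProduct.lift (mul (k := k) i) (S.lTensor B (Coalgebra.comul b)) =
      (Coalgebra.counit b : k) • one k I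

end MultiBialgebra

/-- Objects of the category of `I`-bialgebras over `k`. -/
structure MultiBialgCat.{v, u, w} (k : Type u) [Field k] (I : Type w) where
  /-- The underlying type. -/
  carrier : Type v
  [instAddCommGroup : AddCommGroup carrier]
  [instModule : Module k carrier]
  [instMultiBialgebra : MultiBialgebra k I carrier]

namespace MultiBialgCat

universe v u w

variable {k : Type u} [Field k] {I : Type w}

instance : CoeSort (MultiBialgCat.{v} k I) (Type v) := ⟨carrier⟩

attribute [instance] instAddCommGroup instModule instMultiBialgebra

/-- Morphisms of `I`-bialgebras: coalgebra maps preserving the unit and all multiplications. -/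
@[ext]
structure Hom (A B : MultiBialgCat.{v} k I) where
  /-- The underlying coalgebra map. -/
  toCoalgHom : A →ₗc[k] B
  map_one : toCoalgHom (MultiBialgebra.one k I) = MultiBialgebra.one k I
  map_mul : ∀ (i : I) (a b : A), toCoalgHom (MultiBialgebra.mul (k := k) i a b) =
    MultiBialgebra.mul (k := k) i (toCoalgHom a) (toCoalgHom b)

instance : Category (MultiBialgCat.{v} k I) where
  Hom A B := Hom A B
  id A := ⟨CoalgHom.id k A, rfl, fun _ _ _ => rfl⟩
  comp f g := ⟨g.toCoalgHom.comp f.toCoalgHom,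
    by simp [f.map_one, g.map_one], fun i a b => by simp [f.map_mul, g.map_mul]⟩

/-- The bialgebra structures labelled by `J` are Hopf, i.e. have antipodes. -/
def isHopf (k : Type u) [Field k] {I : Type w} (J : Set I) :
    ObjectProperty (MultiBialgCat.{v} k I) :=
  fun B => ∀ j ∈ J, ∃ S : B →ₗ[k] B, MultiBialgebra.IsAntipode j S

/-- The underlying coalgebra is cocommutative. -/
def isCocomm (k : Type u) [Field k] (I : Type w) :
    ObjectProperty (MultiBialgCat.{v} k I) :=
  fun B => Coalgebra.IsCocomm k B

lemma isHopf_anti (k : Type u) [Field k] {I : Type w} {J' J : Set I} (h : J' ⊆ J) :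
    isHopf.{v} k J ≤ isHopf.{v} k J' :=
  fun _ hB j hj => hB j (h hj)

lemma isHopf_inf_isCocomm_anti (k : Type u) [Field k] {I : Type w} {J' J : Set I} (h : J' ⊆ J) :
    isHopf.{v} k J ⊓ isCocomm.{v} k I ≤ isHopf.{v} k J' ⊓ isCocomm.{v} k I :=
  inf_le_inf_right _ (isHopf_anti k h)

end MultiBialgCat

universe v u w

/-- The category of `(I,J)`-Hopf algebras: the `I`-bialgebras whose `J`-indexed bialgebra structures
are Hopf. Antipodes are unique and are preserved by all bialgebra morphisms, so this is a full
subcategory of the category of `I`-bialgebras. -/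
abbrev HalgCat (k : Type u) [Field k] {I : Type w} (J : Set I) :=
  (MultiBialgCat.isHopf.{v} k J).FullSubcategory

/-- The category of cocommutative `(I,J)`-Hopf algebras. -/
abbrev CocommHalgCat (k : Type u) [Field k] {I : Type w} (J : Set I) :=
  (MultiBialgCat.isHopf.{v} k J ⊓ MultiBialgCat.isCocomm.{v} k I).FullSubcategory

/-- The functor from `(I,J)`-Hopf algebras to `(I,J')`-Hopf algebras, for `J' ⊆ J`, that forgets the
antipodes labelled by `J \ J'`. -/
abbrev HalgCat.forget (k : Type u) [Field k] {I : Type w} {J' J : Set I} (h : J' ⊆ J) :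
    HalgCat.{v} k J ⥤ HalgCat.{v} k J' :=
  ObjectProperty.ιOfLE (MultiBialgCat.isHopf_anti k h)

/-- The cocommutative version of `HalgCat.forget`. -/
abbrev CocommHalgCat.forget (k : Type u) [Field k] {I : Type w} {J' J : Set I} (h : J' ⊆ J) :
    CocommHalgCat.{v} k J ⥤ CocommHalgCat.{v} k J' :=
  ObjectProperty.ιOfLE (MultiBialgCat.isHopf_inf_isCocomm_anti k h)

/-! The left adjoint sends `B` to the `I`-bialgebra `E` freely generated by `B` and operators `S_j`,
`j ∈ J`. Antipodes that `B` already has need no special care: antipodes are unique and every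
bialgebra map preserves them.

Let `T` be the space of formal expressions in a basis of `B`; working from a basis makes all
operations linear by construction. On `T` the maps `Δ` and `ε` are defined by recursion, with `Δ S_j
= τ (S_j ⊗ S_j) Δ` (`τ` the flip), the rule every antipode obeys (`IsAntipode.map_comul`). Thus `T`
is a coalgebra before any algebra axiom holds, and `E = T / R`, where `R` is generated under all
operations by the required identities.

The crux is that `R` is a coideal, and there only the antipode axioms need an argument. In the
convolution algebra `Hom(T, E ⊗ E)`, if `s` is inverse to `p`, then `τ (s ⊗ s) Δ` is inverse to `(p
⊗ p) Δ` (`conv_comm_map_comul`, `conv_map_comul_comm`).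

A bialgebra map from `B` to a Hopf algebra `H` extends to `T` by evaluating expressions with the
antipodes of `H`. Evaluation is a coalgebra map (`map_eval_comp_comul`) and kills `R`
(`eval_eq_zero`). The extension is unique because bialgebra maps commute with antipodes (`hom_ext`).
Cocommutativity passes from `B` to `T` and to `E`, so one construction serves both adjunctions. -/

/-! ### Convolution algebras. -/

section Convolution

open TensorProduct Coalgebra

variable {k C A : Type*} [Field k] [AddCommGroup C] [Module k C] [Coalgebra k C]
  [AddCommGroup A] [Module k A]

/-- The convolution product of linear maps from a coalgebra to a module with a bilinear product. -/
noncomputable def conv (m : A →ₗ[k] A →ₗ[k] A) (f g : C →ₗ[k] A) : C →ₗ[k] A :=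
  lift m ∘ₗ map f g ∘ₗ comul

/-- The neutral element of convolution attached to a unit `e`. -/
noncomputable def convOne (C : Type*) [AddCommGroup C] [Module k C] [Coalgebra k C] (e : A) :
    C →ₗ[k] A :=
  (counit : C →ₗ[k] k).smulRight e

@[simp] lemma convOne_apply (e : A) (c : C) :
    convOne (k := k) C e c = (counit c : k) • e := rfl

lemma conv_assoc {m : A →ₗ[k] A →ₗ[k] A} (hm : ∀ a b c, m (m a b) c = m a (m b c))
    (f g h : C →ₗ[k] A) : conv m (conv m f g) h = conv m f (conv m g h) := by
  have h1 : conv m (conv m f g) h =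
      (lift m ∘ₗ map (lift m ∘ₗ map f g) h) ∘ₗ comul.rTensor C ∘ₗ comul := by
    simp only [conv, ← LinearMap.comp_assoc]
    simp [LinearMap.comp_assoc]
  have h2 : conv m f (conv m g h) =
      (lift m ∘ₗ map f (lift m ∘ₗ map g h)) ∘ₗ comul.lTensor C ∘ₗ comul := by
    simp only [conv, ← LinearMap.comp_assoc]
    simp [LinearMap.comp_assoc]
  have h3 : lift m ∘ₗ map (lift m ∘ₗ map f g) h =
      (lift m ∘ₗ map f (lift m ∘ₗ map g h)) ∘ₗ (TensorProduct.assoc k C C C).toLinearMap := by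
    ext a b c
    simp [hm]
  rw [h1, h2, h3, ← coassoc, LinearMap.comp_assoc]

lemma convOne_conv {m : A →ₗ[k] A →ₗ[k] A} {e : A} (he : ∀ a, m e a = a) (f : C →ₗ[k] A) :
    conv m (convOne C e) f = f := by
  have h : lift m ∘ₗ map (convOne C e) f =
      (f ∘ₗ (TensorProduct.lid k C).toLinearMap) ∘ₗ (counit : C →ₗ[k] k).rTensor C := by
    ext a b
    simp [he]
  rw [conv, ← LinearMap.comp_assoc, h]
  ext c
  simp

lemma conv_convOne {m : A →ₗ[k] A →ₗ[k] A} {e : A} (he : ∀ a, m a e = a) (f : C →ₗ[k] A) :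
    conv m f (convOne C e) = f := by
  have h : lift m ∘ₗ map f (convOne C e) =
      (f ∘ₗ (TensorProduct.rid k C).toLinearMap) ∘ₗ (counit : C →ₗ[k] k).lTensor C := by
    ext a b
    simp [he]
  rw [conv, ← LinearMap.comp_assoc, h]
  ext c
  simp

/-- Left and right convolution inverses agree. -/
lemma conv_inverse_unique {m : A →ₗ[k] A →ₗ[k] A} {e : A}
    (hm : ∀ a b c, m (m a b) c = m a (m b c)) (hl : ∀ a, m e a = a) (hr : ∀ a, m a e = a)
    {f g h : C →ₗ[k] A} (hfg : conv m f g = convOne C e) (hgh : conv m g h = convOne C e) :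
    f = h := by
  rw [← conv_convOne hr f, ← hgh, ← conv_assoc hm, hfg, convOne_conv hl]

/-- Convolution is compatible with multiplicative maps of the target. -/
lemma comp_conv {A' : Type*} [AddCommGroup A'] [Module k A'] {m : A →ₗ[k] A →ₗ[k] A}
    {m' : A' →ₗ[k] A' →ₗ[k] A'} (φ : A →ₗ[k] A') (hφ : ∀ a b, φ (m a b) = m' (φ a) (φ b))
    (f g : C →ₗ[k] A) : φ ∘ₗ conv m f g = conv m' (φ ∘ₗ f) (φ ∘ₗ g) := by
  have h : φ ∘ₗ lift m ∘ₗ map f g = lift m' ∘ₗ map (φ ∘ₗ f) (φ ∘ₗ g) := by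
    ext a b
    simp [hφ]
  simp only [conv, ← LinearMap.comp_assoc, ← h]

/-- Convolution is compatible with coalgebra maps of the source. -/
lemma conv_comp {C' : Type*} [AddCommGroup C'] [Module k C'] [Coalgebra k C']
    {m : A →ₗ[k] A →ₗ[k] A} (φ : C' →ₗ[k] C)
    (hφ : map φ φ ∘ₗ comul = comul ∘ₗ φ)
    (f g : C →ₗ[k] A) : conv m f g ∘ₗ φ = conv m (f ∘ₗ φ) (g ∘ₗ φ) := by
  simp only [conv, map_comp, LinearMap.comp_assoc, hφ]

lemma map₂_assoc {m : A →ₗ[k] A →ₗ[k] A} (hm : ∀ a b c, m (m a b) c = m a (m b c))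
    (x y z : A ⊗[k] A) :
    map₂ m m (map₂ m m x y) z = map₂ m m x (map₂ m m y z) := by
  induction x with
  | zero => simp
  | add x x' hx hx' => simp only [map_add, LinearMap.add_apply, hx, hx']
  | tmul a b =>
    induction y with
    | zero => simp
    | add x x' hx hx' => simp only [map_add, LinearMap.add_apply, hx, hx']
    | tmul c d =>
      induction z with
      | zero => simp
      | add x x' hx hx' => simp only [map_add, hx, hx']
      | tmul => simp [hm]

lemma map₂_one_left {m : A →ₗ[k] A →ₗ[k] A} {e : A} (he : ∀ a, m e a = a) (x : A ⊗[k] A) :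
    map₂ m m (e ⊗ₜ e) x = x := by
  induction x with
  | zero => simp
  | add x x' hx hx' => simp only [map_add, hx, hx']
  | tmul => simp [he]

lemma map₂_one_right {m : A →ₗ[k] A →ₗ[k] A} {e : A} (he : ∀ a, m a e = a) (x : A ⊗[k] A) :
    map₂ m m x (e ⊗ₜ e) = x := by
  induction x with
  | zero => simp
  | add x x' hx hx' => simp only [map_add, LinearMap.add_apply, hx, hx']
  | tmul => simp [he]

section
variable {m : A →ₗ[k] A →ₗ[k] A} {e : A} (hl : ∀ a, m e a = a) (hr : ∀ a, m a e = a)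
  (p s : C →ₗ[k] A)
include hl hr

/-- Factors `(p ⊗ s) Δ` as the convolution of `p ⊗ 1` with `1 ⊗ s`. Multiplying such factors in the
opposite order brings in the flip, as in the next lemma. Both serve to turn antipode identities in
`A ⊗ A` into telescoping products. -/
lemma conv_map₂_mk_flip_mk : conv (map₂ m m) ((mk k A A).flip e ∘ₗ p) (mk k A A e ∘ₗ s) =
    map p s ∘ₗ comul := by
  have h : lift (map₂ m m) ∘ₗ map ((mk k A A).flip e ∘ₗ p) (mk k A A e ∘ₗ s) = map p s := by
    ext a b
    simp [hl, hr]
  rw [conv, ← LinearMap.comp_assoc, h]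

lemma conv_map₂_mk_mk_flip : conv (map₂ m m) (mk k A A e ∘ₗ p) ((mk k A A).flip e ∘ₗ s) =
    (TensorProduct.comm k A A).toLinearMap ∘ₗ map p s ∘ₗ comul := by
  have h : lift (map₂ m m) ∘ₗ map (mk k A A e ∘ₗ p) ((mk k A A).flip e ∘ₗ s) =
      (TensorProduct.comm k A A).toLinearMap ∘ₗ map p s := by
    ext a b
    simp [hl, hr]
  rw [conv, ← LinearMap.comp_assoc, h, LinearMap.comp_assoc]

variable (hm : ∀ a b c, m (m a b) c = m a (m b c)) {p s}
include hm

/-- If `s` is left convolution inverse to `p`, then `s₂ ⊗ s₁` is left inverse to `p₁ ⊗ p₂`. -/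
lemma conv_comm_map_comul (h : conv m s p = convOne C e) :
    conv (map₂ m m) ((TensorProduct.comm k A A).toLinearMap ∘ₗ map s s ∘ₗ comul)
      (map p p ∘ₗ comul) = convOne C (e ⊗ₜ[k] e) := by
  have hM := map₂_assoc hm
  have hL := map₂_one_left hl
  -- The product is `(1 ⊗ s) * (s ⊗ 1) * (p ⊗ 1) * (1 ⊗ p)`. The middle pair cancels by `s * p = 1`,
  -- and then so does the outer pair.
  rw [← conv_map₂_mk_mk_flip hl hr, ← conv_map₂_mk_flip_mk hl hr, conv_assoc hM,
    ← conv_assoc hM ((mk k A A).flip e ∘ₗ s),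
    ← comp_conv (m := m) ((mk k A A).flip e) (by simp [hl]), h]
  have : (mk k A A).flip e ∘ₗ convOne C e = convOne C (e ⊗ₜ[k] e) := by ext; simp [smul_tmul']
  rw [this, convOne_conv hL, ← comp_conv (m := m) (mk k A A e) (by simp [hl]), h]
  ext; simp

/-- If `s` is right convolution inverse to `p`, then `s₂ ⊗ s₁` is right inverse to `p₁ ⊗ p₂`. -/
lemma conv_map_comul_comm (h : conv m p s = convOne C e) :
    conv (map₂ m m) (map p p ∘ₗ comul)
      ((TensorProduct.comm k A A).toLinearMap ∘ₗ map s s ∘ₗ comul) =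
      convOne C (e ⊗ₜ[k] e) := by
  have hM := map₂_assoc hm
  have hL := map₂_one_left hl
  -- Here the product is `(p ⊗ 1) * (1 ⊗ p) * (1 ⊗ s) * (s ⊗ 1)`, again cancelled from the inside.
  rw [← conv_map₂_mk_mk_flip hl hr, ← conv_map₂_mk_flip_mk hl hr, conv_assoc hM,
    ← conv_assoc hM (mk k A A e ∘ₗ p),
    ← comp_conv (m := m) (mk k A A e) (by simp [hl]), h]
  have : mk k A A e ∘ₗ convOne C e = convOne C (e ⊗ₜ[k] e) := by ext; simp
  rw [this, convOne_conv hL, ← comp_conv (m := m) ((mk k A A).flip e) (by simp [hl]), h]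
  ext; simp [smul_tmul']

end

end Convolution

/-! ### Compatibility of antipodes with comultiplication, counit and bialgebra maps. -/

namespace MultiBialgebra.IsAntipode

open TensorProduct Coalgebra

variable {k I B : Type*} [Field k] [AddCommGroup B] [Module k B] [MultiBialgebra k I B]
  {i : I} {S : B →ₗ[k] B}

lemma conv_left (h : IsAntipode i S) : conv (mul (k := k) i) S .id = convOne B (one k I) :=
  LinearMap.ext h.mul_rTensor_comul

lemma conv_right (h : IsAntipode i S) : conv (mul (k := k) i) .id S = convOne B (one k I) :=
  LinearMap.ext h.mul_lTensor_comul

lemma of_conv (h : conv (mul (k := k) i) S .id = convOne B (one k I))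
    (h' : conv (mul (k := k) i) .id S = convOne B (one k I)) : IsAntipode i S :=
  ⟨LinearMap.congr_fun h, LinearMap.congr_fun h'⟩

/-- In `Hom(B, B ⊗ B)` the left side is a left convolution inverse of `Δ`, since `Δ` is
multiplicative, and the right side is a right inverse, so they agree. -/
lemma map_comul (h : IsAntipode i S) :
    comul ∘ₗ S = (TensorProduct.comm k B B).toLinearMap ∘ₗ map S S ∘ₗ comul := by
  have key := conv_map_comul_comm (C := B) (MultiBialgebra.one_mul i) (MultiBialgebra.mul_one i)
    (MultiBialgebra.mul_assoc i) h.conv_right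
  have key' := comp_conv (C := B) comul (comul_mul (k := k) (B := B) i) S .id
  rw [h.conv_left] at key'
  refine conv_inverse_unique (map₂_assoc (MultiBialgebra.mul_assoc i))
    (map₂_one_left (MultiBialgebra.one_mul i)) (map₂_one_right (MultiBialgebra.mul_one i))
    (e := one k I ⊗ₜ one k I) (g := comul) ?_ (by simpa using key)
  rw [LinearMap.comp_id] at key'
  rw [← key']
  ext; simp [comul_one]

/-- The counit is neutral for convolution in `Hom(B, k)`, so `ε S = (ε S) * ε = ε (S * id) = ε`. -/
lemma counit_comp (h : IsAntipode i S) : counit ∘ₗ S = (counit : B →ₗ[k] k) := by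
  have key := comp_conv (C := B) (m' := LinearMap.mul k k) counit
    (counit_mul (k := k) (B := B) i) S .id
  rw [h.conv_left, LinearMap.comp_id] at key
  have := conv_convOne (C := B) (m := LinearMap.mul k k) (e := 1) (by simp) (counit ∘ₗ S)
  have h1 : convOne B (1 : k) = counit := by ext; simp
  rw [h1, ← key] at this
  rw [← this]
  ext; simp [counit_one]

/-- Maps of bialgebras preserve antipodes. -/
lemma map_comp {B' : Type*} [AddCommGroup B'] [Module k B'] [MultiBialgebra k I B']
    {S' : B' →ₗ[k] B'} (h : IsAntipode i S) (h' : IsAntipode i S') (f : B →ₗc[k] B')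
    (map_one : f (one k I) = one k I)
    (map_mul : ∀ a b, f (mul (k := k) i a b) = mul (k := k) i (f a) (f b)) (b : B) :
    f (S b) = S' (f b) := by
  have h1 := comp_conv (C := B) f.toLinearMap map_mul S .id
  have h2 := conv_comp (m := mul (k := k) i) f.toLinearMap f.map_comp_comul .id S'
  rw [h.conv_left] at h1
  rw [h'.conv_right] at h2
  -- In `Hom(B, B')`, `f ∘ S` is a left and `S' ∘ f` a right convolution inverse of `f`.
  refine LinearMap.congr_fun (conv_inverse_unique (MultiBialgebra.mul_assoc i)
    (MultiBialgebra.one_mul i) (MultiBialgebra.mul_one i)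
    (f := f.toLinearMap ∘ₗ S) (g := f.toLinearMap) (h := S' ∘ₗ f.toLinearMap)
    (e := one k I) ?_ ?_) b
  · rw [LinearMap.comp_id] at h1
    rw [← h1]
    ext; simp [map_one]
  · rw [LinearMap.id_comp] at h2
    rw [← h2]
    ext; simp

end MultiBialgebra.IsAntipode

/-! ### The coalgebra of formal expressions. -/

namespace HopfEnvelope

open TensorProduct Coalgebra

/-- Formal expressions in generators `X`, a constant, binary operations labelled by `I` and unary
operations labelled by `J`. -/
inductive Term (X I J : Type*)
  | gen (x : X)
  | one
  | mul (i : I) (s t : Term X I J)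
  | anti (j : J) (t : Term X I J)

variable (k I J B : Type*) [Field k] [AddCommGroup B] [Module k B]

/-- The vector space on all formal expressions in the vectors of a basis of `B`: the free space
containing `B` with a constant, bilinear products labelled by `I` and linear endomorphisms
labelled by `J`. -/
def TermSpace := Term (Module.Basis.ofVectorSpaceIndex k B) I J →₀ k

noncomputable instance : AddCommGroup (TermSpace k I J B) :=
  inferInstanceAs (AddCommGroup (Term (Module.Basis.ofVectorSpaceIndex k B) I J →₀ k))

noncomputable instance : Module k (TermSpace k I J B) :=
  inferInstanceAs (Module k (Term (Module.Basis.ofVectorSpaceIndex k B) I J →₀ k))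

namespace TermSpace

/-- The basis of formal expressions. -/
noncomputable def basis :
    Module.Basis (Term (Module.Basis.ofVectorSpaceIndex k B) I J) k (TermSpace k I J B) :=
  ⟨LinearEquiv.refl k _⟩

/-- The inclusion of the generators. -/
noncomputable def incl : B →ₗ[k] TermSpace k I J B :=
  (Module.Basis.ofVectorSpace k B).constr k fun x => basis k I J B (.gen x)

/-- The formal unit. -/
noncomputable def one : TermSpace k I J B := basis k I J B .one

variable {k I J B}

/-- The formal products. -/
noncomputable def mul (i : I) :
    TermSpace k I J B →ₗ[k] TermSpace k I J B →ₗ[k] TermSpace k I J B :=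
  (basis k I J B).constr k fun s => (basis k I J B).constr k fun t => basis k I J B (.mul i s t)

/-- The formal antipodes. -/
noncomputable def anti (j : J) : TermSpace k I J B →ₗ[k] TermSpace k I J B :=
  (basis k I J B).constr k fun t => basis k I J B (.anti j t)

lemma basis_gen (x : Module.Basis.ofVectorSpaceIndex k B) :
    basis k I J B (.gen x) = incl k I J B (Module.Basis.ofVectorSpace k B x) := by
  rw [incl, Module.Basis.constr_basis]

lemma basis_mul (i : I) (s t : Term (Module.Basis.ofVectorSpaceIndex k B) I J) :
    basis k I J B (.mul i s t) = mul i (basis k I J B s) (basis k I J B t) := by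
  simp [mul, Module.Basis.constr_basis]

lemma basis_anti (j : J) (t : Term (Module.Basis.ofVectorSpaceIndex k B) I J) :
    basis k I J B (.anti j t) = anti j (basis k I J B t) := by
  simp [anti, Module.Basis.constr_basis]

/-- A subspace containing the generators and closed under all operations is everything. -/
lemma eq_top_of_closed (P : Submodule k (TermSpace k I J B)) (hincl : ∀ b, incl k I J B b ∈ P)
    (hone : one k I J B ∈ P) (hmul : ∀ i, ∀ x ∈ P, ∀ y ∈ P, mul i x y ∈ P)
    (hanti : ∀ j, ∀ x ∈ P, anti j x ∈ P) : P = ⊤ := by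
  rw [← top_le_iff, ← (basis k I J B).span_eq, Submodule.span_le]
  rintro _ ⟨t, rfl⟩
  induction t with
  | gen x => exact basis_gen (I := I) (J := J) x ▸ hincl _
  | one => exact hone
  | mul i s t hs ht => exact basis_mul i s t ▸ hmul i _ hs _ ht
  | anti j t ht => exact basis_anti j t ▸ hanti j _ ht

/-- Linear maps agreeing on generators and compatibly with all operations are equal. -/
lemma linearMap_ext {M : Type*} [AddCommGroup M] [Module k M] {f g : TermSpace k I J B →ₗ[k] M}
    (hincl : ∀ b, f (incl k I J B b) = g (incl k I J B b))
    (hone : f (one k I J B) = g (one k I J B))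
    (hmul : ∀ i x y, f x = g x → f y = g y → f (mul i x y) = g (mul i x y))
    (hanti : ∀ j x, f x = g x → f (anti j x) = g (anti j x)) : f = g := by
  rw [← LinearMap.eqLocus_eq_top]
  exact eq_top_of_closed _ hincl hone (fun i x hx y hy => hmul i x y hx hy) hanti

section lift

variable {M : Type*} [AddCommGroup M] [Module k M] (f : B →ₗ[k] M) (e : M)
  (m : I → M →ₗ[k] M →ₗ[k] M) (S : J → M →ₗ[k] M)

/-- Evaluation of formal expressions. -/
noncomputable def liftTerm : Term (Module.Basis.ofVectorSpaceIndex k B) I J → M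
  | .gen x => f (Module.Basis.ofVectorSpace k B x)
  | .one => e
  | .mul i s t => m i (liftTerm s) (liftTerm t)
  | .anti j t => S j (liftTerm t)

/-- The universal property of `TermSpace`. -/
noncomputable def lift : TermSpace k I J B →ₗ[k] M :=
  (basis k I J B).constr k (liftTerm f e m S)

lemma lift_incl (b : B) : lift f e m S (incl k I J B b) = f b := by
  suffices lift f e m S ∘ₗ incl k I J B = f from LinearMap.congr_fun this b
  refine (Module.Basis.ofVectorSpace k B).ext fun x => ?_
  rw [LinearMap.comp_apply, ← basis_gen, lift, Module.Basis.constr_basis, liftTerm]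

lemma lift_one : lift f e m S (one k I J B) = e := by
  rw [lift, one, Module.Basis.constr_basis, liftTerm]

lemma lift_mul (i : I) (x y : TermSpace k I J B) :
    lift f e m S (mul i x y) = m i (lift f e m S x) (lift f e m S y) := by
  suffices (mul i).compr₂ (lift f e m S) = (m i).compl₁₂ (lift f e m S) (lift f e m S) from
    LinearMap.congr_fun₂ this x y
  refine (basis k I J B).ext fun s => (basis k I J B).ext fun t => ?_
  simp only [LinearMap.compr₂_apply, LinearMap.compl₁₂_apply, ← basis_mul]
  simp only [lift, Module.Basis.constr_basis, liftTerm]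

lemma lift_anti (j : J) (x : TermSpace k I J B) :
    lift f e m S (anti j x) = S j (lift f e m S x) := by
  suffices lift f e m S ∘ₗ anti j = S j ∘ₗ lift f e m S from LinearMap.congr_fun this x
  refine (basis k I J B).ext fun t => ?_
  simp only [LinearMap.comp_apply, ← basis_anti]
  simp only [lift, Module.Basis.constr_basis, liftTerm]

end lift

variable [Coalgebra k B]

/-- The values on formal antipodes are forced: antipodes preserve the counit and reverse the
comultiplication. -/
noncomputable instance : CoalgebraStruct k (TermSpace k I J B) where
  comul := lift (map (incl k I J B) (incl k I J B) ∘ₗ comul) (one k I J B ⊗ₜ one k I J B)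
    (fun i => map₂ (mul i) (mul i))
    (fun j => (TensorProduct.comm k _ _).toLinearMap ∘ₗ map (anti j) (anti j))
  counit := lift counit 1 (fun _ => LinearMap.mul k k) (fun _ => .id)

lemma comul_incl (b : B) :
    comul (R := k) (incl k I J B b) = map (incl k I J B) (incl k I J B) (comul b) :=
  lift_incl ..

lemma comul_one : comul (R := k) (one k I J B) = one k I J B ⊗ₜ one k I J B :=
  lift_one ..

lemma comul_mul (i : I) (x y : TermSpace k I J B) :
    comul (R := k) (mul i x y) = map₂ (mul i) (mul i) (comul x) (comul y) :=
  lift_mul ..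

lemma comul_anti (j : J) (x : TermSpace k I J B) :
    comul (R := k) (anti j x) = TensorProduct.comm k _ _ (map (anti j) (anti j) (comul x)) :=
  lift_anti ..

@[simp] lemma counit_incl (b : B) : counit (R := k) (incl k I J B b) = counit b :=
  lift_incl ..

@[simp] lemma counit_one : counit (R := k) (one k I J B) = 1 :=
  lift_one ..

@[simp] lemma counit_mul (i : I) (x y : TermSpace k I J B) :
    counit (R := k) (mul i x y) = counit x * counit y :=
  lift_mul ..

@[simp] lemma counit_anti (j : J) (x : TermSpace k I J B) :
    counit (R := k) (anti j x) = counit x :=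
  lift_anti ..

end TermSpace

section

variable {k : Type*} [Field k] {M N P M' N' P' : Type*} [AddCommGroup M] [Module k M]
  [AddCommGroup N] [Module k N] [AddCommGroup P] [Module k P] [AddCommGroup M'] [Module k M']
  [AddCommGroup N'] [Module k N'] [AddCommGroup P'] [Module k P']

lemma map_map₂ {f : M →ₗ[k] M'} {g : N →ₗ[k] N'} {m : M →ₗ[k] M →ₗ[k] M}
    {m' : M' →ₗ[k] M' →ₗ[k] M'} {n : N →ₗ[k] N →ₗ[k] N} {n' : N' →ₗ[k] N' →ₗ[k] N'}
    (hf : ∀ a b, f (m a b) = m' (f a) (f b)) (hg : ∀ a b, g (n a b) = n' (g a) (g b))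
    (x y : M ⊗[k] N) :
    map f g (map₂ m n x y) = map₂ m' n' (map f g x) (map f g y) := by
  suffices (map₂ m n).compr₂ (map f g) = (map₂ m' n').compl₁₂ (map f g) (map f g) from
    LinearMap.congr_fun₂ this x y
  ext a b c d
  simp [hf, hg]

lemma assoc_map₂ (m : M →ₗ[k] M →ₗ[k] M) (n : N →ₗ[k] N →ₗ[k] N) (p : P →ₗ[k] P →ₗ[k] P)
    (x y : (M ⊗[k] N) ⊗[k] P) :
    TensorProduct.assoc k M N P (map₂ (map₂ m n) p x y) =
      map₂ m (map₂ n p) (TensorProduct.assoc k M N P x) (TensorProduct.assoc k M N P y) := by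
  suffices (map₂ (map₂ m n) p).compr₂ (TensorProduct.assoc k M N P).toLinearMap =
      (map₂ m (map₂ n p)).compl₁₂ (TensorProduct.assoc k M N P).toLinearMap
        (TensorProduct.assoc k M N P).toLinearMap from
    LinearMap.congr_fun₂ this x y
  ext a b c d e f
  simp

lemma comm_map₂ (m : M →ₗ[k] M →ₗ[k] M) (n : N →ₗ[k] N →ₗ[k] N) (x y : M ⊗[k] N) :
    TensorProduct.comm k M N (map₂ m n x y) =
      map₂ n m (TensorProduct.comm k M N x) (TensorProduct.comm k M N y) := by
  suffices (map₂ m n).compr₂ (TensorProduct.comm k M N).toLinearMap =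
      (map₂ n m).compl₁₂ (TensorProduct.comm k M N).toLinearMap
        (TensorProduct.comm k M N).toLinearMap from
    LinearMap.congr_fun₂ this x y
  ext a b c d
  simp

end

namespace TermSpace

variable {k I J B} [Coalgebra k B]

/-- The map `x ⊗ y ↦ anti y ⊗ anti x`. -/
noncomputable abbrev commAnti (j : J) :
    TermSpace k I J B ⊗[k] TermSpace k I J B →ₗ[k] TermSpace k I J B ⊗[k] TermSpace k I J B :=
  (TensorProduct.comm k _ _).toLinearMap ∘ₗ map (anti j) (anti j)

/-- The two counit laws have to be proved together: formal antipodes swap the tensor factors, so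
each law for `anti j x` rests on the other law for `x`. -/
lemma counit_comul (x : TermSpace k I J B) :
    (counit (R := k)).rTensor (TermSpace k I J B) (comul x) = 1 ⊗ₜ x ∧
      (counit (R := k)).lTensor (TermSpace k I J B) (comul x) = x ⊗ₜ 1 := by
  suffices LinearMap.eqLocus
        ((counit (R := k)).rTensor (TermSpace k I J B) ∘ₗ comul) (mk k _ _ 1) ⊓
      LinearMap.eqLocus ((counit (R := k)).lTensor (TermSpace k I J B) ∘ₗ comul)
        ((mk k _ _).flip 1) = ⊤ from (this ▸ Submodule.mem_top : x ∈ _)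
  refine eq_top_of_closed _ (fun b => ?_) ?_ (fun i x hx y hy => ?_) (fun j x hx => ?_)
  · have h1 : (counit (R := k)).rTensor (TermSpace k I J B) ∘ₗ
        map (incl k I J B) (incl k I J B) = (incl k I J B).lTensor k ∘ₗ counit.rTensor B := by
      ext; simp
    have h2 : (counit (R := k)).lTensor (TermSpace k I J B) ∘ₗ
        map (incl k I J B) (incl k I J B) = (incl k I J B).rTensor k ∘ₗ counit.lTensor B := by
      ext; simp
    have h1' := LinearMap.congr_fun h1 (comul b)
    have h2' := LinearMap.congr_fun h2 (comul b)
    simp only [LinearMap.comp_apply, rTensor_counit_comul, lTensor_counit_comul,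
      LinearMap.lTensor_tmul, LinearMap.rTensor_tmul] at h1' h2'
    simp [comul_incl, h1', h2']
  · simp [comul_one]
  · simp only [Submodule.mem_inf, LinearMap.mem_eqLocus, LinearMap.comp_apply, LinearMap.rTensor,
      LinearMap.lTensor, mk_apply, LinearMap.flip_apply] at hx hy ⊢
    rw [comul_mul, map_map₂ (M := TermSpace k I J B) (N := TermSpace k I J B) (counit_mul i)
        (m' := LinearMap.mul k k) (N' := TermSpace k I J B)
        (g := .id) (n' := mul i) (fun _ _ => rfl),
      map_map₂ (M := TermSpace k I J B) (N := TermSpace k I J B) (M' := TermSpace k I J B)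
        (f := .id) (m' := mul i)
        (fun _ _ => rfl) (n' := LinearMap.mul k k) (counit_mul i), hx.1, hy.1, hx.2, hy.2]
    simp
  · have h1 : (counit (R := k)).rTensor (TermSpace k I J B) ∘ₗ commAnti j =
        (TensorProduct.comm k _ _).toLinearMap ∘ₗ (anti j).rTensor k ∘ₗ counit.lTensor _ := by
      ext; simp
    have h2 : (counit (R := k)).lTensor (TermSpace k I J B) ∘ₗ commAnti j =
        (TensorProduct.comm k _ _).toLinearMap ∘ₗ (anti j).lTensor k ∘ₗ counit.rTensor _ := by
      ext; simp
    have h1' := LinearMap.congr_fun h1 (comul x)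
    have h2' := LinearMap.congr_fun h2 (comul x)
    simp only [Submodule.mem_inf, LinearMap.mem_eqLocus, LinearMap.comp_apply, mk_apply,
      LinearMap.flip_apply, LinearEquiv.coe_coe] at h1' h2' hx ⊢
    rw [comul_anti, h1', h2', hx.1, hx.2]
    simp

noncomputable instance : Coalgebra k (TermSpace k I J B) where
  coassoc := by
    refine linearMap_ext (fun b => ?_) ?_ (fun i x y hx hy => ?_) (fun j x hx => ?_)
    · have h1 : (comul (R := k)).rTensor (TermSpace k I J B) ∘ₗ
          map (incl k I J B) (incl k I J B) =
          map (map (incl k I J B) (incl k I J B)) (incl k I J B) ∘ₗ comul.rTensor B := by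
        ext; simp [comul_incl]
      have h2 : (comul (R := k)).lTensor (TermSpace k I J B) ∘ₗ
          map (incl k I J B) (incl k I J B) =
          map (incl k I J B) (map (incl k I J B) (incl k I J B)) ∘ₗ comul.lTensor B := by
        ext; simp [comul_incl]
      have h1' := LinearMap.congr_fun h1 (comul b)
      have h2' := LinearMap.congr_fun h2 (comul b)
      simp only [LinearMap.comp_apply] at h1' h2'
      simp only [LinearMap.comp_apply, comul_incl, h1', h2', LinearEquiv.coe_coe]
      rw [← coassoc_apply, map_map_assoc]
    · simp [comul_one]
    · simp only [LinearMap.comp_apply, LinearEquiv.coe_coe, LinearMap.rTensor, LinearMap.lTensor]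
        at hx hy ⊢
      rw [comul_mul, map_map₂ (M := TermSpace k I J B) (N := TermSpace k I J B) (comul_mul i)
          (N' := TermSpace k I J B)
        (g := .id) (n' := mul i) (fun _ _ => rfl), assoc_map₂, hx, hy,
        map_map₂ (M := TermSpace k I J B) (N := TermSpace k I J B) (M' := TermSpace k I J B)
        (f := .id) (m' := mul i)
          (fun _ _ => rfl) (comul_mul i)]
    -- Applying `anti j` reverses the three tensor factors and so exchanges the two sides of
    -- coassociativity. `h3` says that this reversal is compatible with reassociation.
    · have h1 : (comul (R := k)).rTensor (TermSpace k I J B) ∘ₗ commAnti j =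
          ((TensorProduct.comm k _ _).toLinearMap ∘ₗ map (anti j) (commAnti j)) ∘ₗ
          (comul (R := k)).lTensor (TermSpace k I J B) := by
        ext a b; simp [comul_anti]
      have h2 : (comul (R := k)).lTensor (TermSpace k I J B) ∘ₗ commAnti j =
          ((TensorProduct.comm k _ _).toLinearMap ∘ₗ map (commAnti j) (anti j)) ∘ₗ
          (comul (R := k)).rTensor (TermSpace k I J B) := by
        ext a b; simp [comul_anti]
      have h3 : (TensorProduct.assoc k _ _ _).toLinearMap ∘ₗ
          ((TensorProduct.comm k _ _).toLinearMap ∘ₗ map (anti j) (commAnti j)) ∘ₗ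
          (TensorProduct.assoc k (TermSpace k I J B) (TermSpace k I J B)
            (TermSpace k I J B)).toLinearMap =
          (TensorProduct.comm k _ _).toLinearMap ∘ₗ map (commAnti j) (anti j) := by
        ext a b c; simp
      have h1' := LinearMap.congr_fun h1 (comul x)
      have h2' := LinearMap.congr_fun h2 (comul x)
      have h3' := LinearMap.congr_fun h3 (comul.rTensor _ (comul x))
      simp only [LinearMap.comp_apply, LinearEquiv.coe_coe] at h1' h2' h3' hx ⊢
      rw [comul_anti, h1', h2', ← h3', hx]
  rTensor_counit_comp_comul := LinearMap.ext fun x => (counit_comul x).1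
  lTensor_counit_comp_comul := LinearMap.ext fun x => (counit_comul x).2

instance [IsCocomm k B] : IsCocomm k (TermSpace k I J B) where
  comm_comp_comul := by
    refine linearMap_ext (fun b => ?_) ?_ (fun i x y hx hy => ?_) (fun j x hx => ?_)
    · simp only [LinearMap.comp_apply, LinearEquiv.coe_coe]
      rw [comul_incl, ← map_comm, comm_comul]
    · simp [comul_one]
    · simp only [LinearMap.comp_apply, LinearEquiv.coe_coe] at hx hy ⊢
      rw [comul_mul, comm_map₂, hx, hy]
    · simp only [LinearMap.comp_apply, LinearEquiv.coe_coe] at hx ⊢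
      rw [comul_anti, ← map_comm, hx, ← map_comm, hx]

end TermSpace

end HopfEnvelope

/-! ### The envelope as a quotient bialgebra with antipodes. -/

namespace HopfEnvelope

open TensorProduct Coalgebra

variable {k I : Type*} {J : Set I} {B : Type*} [Field k] [AddCommGroup B] [Module k B]
  [MultiBialgebra k I B]

open TermSpace

/-- The formal expressions which vanish in every Hopf algebra under `B`: they are generated, under
all operations, by the identities of `B` and the axioms of associativity, unit and antipodes. -/
inductive IsRelation : TermSpace k I J B → Prop
  | zero : IsRelation 0
  | add {x y} (hx : IsRelation x) (hy : IsRelation y) : IsRelation (x + y)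
  | smul (c : k) {x} (hx : IsRelation x) : IsRelation (c • x)
  | mul_left (i : I) (x) {y} (hy : IsRelation y) : IsRelation (mul i x y)
  | mul_right (i : I) {x} (y) (hx : IsRelation x) : IsRelation (mul i x y)
  | anti (j : J) {x} (hx : IsRelation x) : IsRelation (anti j x)
  | incl_one : IsRelation (incl k I J B (MultiBialgebra.one k I) - one k I J B)
  | incl_mul (i : I) (a b : B) : IsRelation
      (incl k I J B (MultiBialgebra.mul (k := k) i a b) -
        mul i (incl k I J B a) (incl k I J B b))
  | one_mul (i : I) (x) : IsRelation (mul i (one k I J B) x - x)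
  | mul_one (i : I) (x) : IsRelation (mul i x (one k I J B) - x)
  | mul_assoc (i : I) (x y z) : IsRelation (mul i (mul i x y) z - mul i x (mul i y z))
  | anti_left (j : J) (x) : IsRelation
      (conv (mul j.1) (anti j) .id x - convOne (k := k) (TermSpace k I J B) (one k I J B) x)
  | anti_right (j : J) (x) : IsRelation
      (conv (mul j.1) .id (anti j) x - convOne (k := k) (TermSpace k I J B) (one k I J B) x)

variable (k I J B) in
/-- The subspace of relations. -/
def relations : Submodule k (TermSpace k I J B) where
  carrier := {x | IsRelation x}
  zero_mem' := .zero
  add_mem' := .add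
  smul_mem' c _ := .smul c

variable (k I J B) in
/-- The underlying space of the free `(I, J)`-Hopf algebra on the `I`-bialgebra `B`. -/
abbrev Envelope := TermSpace k I J B ⧸ relations k I J B

namespace Envelope

variable (k I J B) in
/-- The projection from formal expressions. -/
noncomputable abbrev proj : TermSpace k I J B →ₗ[k] Envelope k I J B := (relations k I J B).mkQ

lemma proj_surjective : Function.Surjective (proj k I J B) := Submodule.mkQ_surjective _

lemma proj_eq {x y : TermSpace k I J B} (h : IsRelation (x - y)) :
    proj k I J B x = proj k I J B y :=
  (Submodule.Quotient.eq _).2 h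

lemma proj_eq_zero {x : TermSpace k I J B} (h : IsRelation x) : proj k I J B x = 0 :=
  (Submodule.Quotient.mk_eq_zero _).2 h

/-- The products of the envelope. -/
noncomputable def mul (i : I) :
    Envelope k I J B →ₗ[k] Envelope k I J B →ₗ[k] Envelope k I J B :=
  (relations k I J B).liftQ
    ((relations k I J B).liftQ ((TermSpace.mul i).compr₂ (proj k I J B)).flip
      (fun _ hy => LinearMap.ext fun x => proj_eq_zero (.mul_left i x hy))).flip
    (fun _ hx => LinearMap.ext fun y => by
      obtain ⟨y, rfl⟩ := proj_surjective y
      exact proj_eq_zero (.mul_right i y hx))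

/-- The antipodes of the envelope. -/
noncomputable def anti (j : J) : Envelope k I J B →ₗ[k] Envelope k I J B :=
  (relations k I J B).mapQ (relations k I J B) (TermSpace.anti j) (fun _ hx => .anti j hx)

lemma proj_mul (i : I) (x y : TermSpace k I J B) :
    proj k I J B (TermSpace.mul i x y) = mul i (proj k I J B x) (proj k I J B y) := rfl

lemma mul_assoc (i : I) (a b c : Envelope k I J B) :
    mul i (mul i a b) c = mul i a (mul i b c) := by
  obtain ⟨x, rfl⟩ := proj_surjective a
  obtain ⟨y, rfl⟩ := proj_surjective b
  obtain ⟨z, rfl⟩ := proj_surjective c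
  exact proj_eq (.mul_assoc i x y z)

lemma one_mul (i : I) (a : Envelope k I J B) : mul i (proj k I J B (one k I J B)) a = a := by
  obtain ⟨x, rfl⟩ := proj_surjective a
  exact proj_eq (.one_mul i x)

lemma mul_one (i : I) (a : Envelope k I J B) : mul i a (proj k I J B (one k I J B)) = a := by
  obtain ⟨x, rfl⟩ := proj_surjective a
  exact proj_eq (.mul_one i x)

/-- The antipode axiom in `Hom(T, E)`, with the formal coalgebra `T` as source. In this form it is
available before `E` is known to be a coalgebra, and so can be used to show that the relations form
a coideal. -/
lemma conv_anti_proj (j : J) :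
    conv (mul j.1) (proj k I J B ∘ₗ TermSpace.anti j) (proj k I J B) =
      convOne (k := k) (TermSpace k I J B) (proj k I J B (one k I J B)) := by
  have := comp_conv (proj k I J B) (proj_mul j.1) (TermSpace.anti j) .id
  rw [LinearMap.comp_id] at this
  rw [← this]
  ext1 x
  exact (proj_eq (.anti_left j x)).trans (map_smul _ _ _)

lemma conv_proj_anti (j : J) :
    conv (mul j.1) (proj k I J B) (proj k I J B ∘ₗ TermSpace.anti j) =
      convOne (k := k) (TermSpace k I J B) (proj k I J B (one k I J B)) := by
  have := comp_conv (proj k I J B) (proj_mul j.1) .id (TermSpace.anti j)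
  rw [LinearMap.comp_id] at this
  rw [← this]
  ext1 x
  exact (proj_eq (.anti_right j x)).trans (map_smul _ _ _)

variable (k I J B) in
/-- The comultiplication followed by the projection. -/
noncomputable def projComul : TermSpace k I J B →ₗ[k] Envelope k I J B ⊗[k] Envelope k I J B :=
  map (proj k I J B) (proj k I J B) ∘ₗ comul

lemma projComul_mul (i : I) (x y : TermSpace k I J B) :
    projComul k I J B (TermSpace.mul i x y) =
      map₂ (mul i) (mul i) (projComul k I J B x) (projComul k I J B y) := by
  simp only [projComul, LinearMap.comp_apply, comul_mul]
  exact map_map₂ (proj_mul i) (proj_mul i) _ _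

lemma projComul_one : projComul k I J B (one k I J B) =
    proj k I J B (one k I J B) ⊗ₜ proj k I J B (one k I J B) := by
  simp [projComul, comul_one]

lemma projComul_anti (j : J) : projComul k I J B ∘ₗ TermSpace.anti j =
    (TensorProduct.comm k _ _).toLinearMap ∘ₗ
      map (proj k I J B ∘ₗ TermSpace.anti j) (proj k I J B ∘ₗ TermSpace.anti j) ∘ₗ comul := by
  ext1 x
  simp only [projComul, LinearMap.comp_apply, comul_anti, map_comp, LinearEquiv.coe_coe, map_comm]

lemma projComul_anti_apply (j : J) (x : TermSpace k I J B) :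
    projComul k I J B (TermSpace.anti j x) =
      TensorProduct.comm k _ _ (map (anti j) (anti j) (projComul k I J B x)) := by
  have h : proj k I J B ∘ₗ TermSpace.anti j = anti j ∘ₗ proj k I J B := rfl
  rw [← LinearMap.comp_apply (projComul k I J B), projComul_anti, h, map_comp]
  rfl

lemma counit_comp_anti (j : J) :
    counit ∘ₗ TermSpace.anti j = counit (R := k) (A := TermSpace k I J B) := by
  ext1 x
  rw [LinearMap.comp_apply, counit_anti]

lemma conv_counit_counit : conv (LinearMap.mul k k) (counit (R := k) (A := TermSpace k I J B))
    counit = counit := by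
  have h : convOne (TermSpace k I J B) (1 : k) = counit := by ext; simp
  conv_lhs => rw [← h]
  rw [convOne_conv (by simp), h]

/-- By induction on how a relation is generated. Closure under the operations and the identities of
`B` are handled by the recursive formulas for `ε` and `Δ`, associativity and units by the same laws
in `E ⊗ E`. -/
instance : (relations k I J B).IsCoideal where
  counit_eq_zero x hx := by
    induction hx with
    | zero => simp
    | add _ _ hx hy => simp [hx, hy]
    | smul c _ hx => simp [hx]
    | mul_left i x _ hy => simp [hy]
    | mul_right i y _ hx => simp [hx]
    | anti j _ hx => simp [hx]
    | incl_one => simp [MultiBialgebra.counit_one]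
    | incl_mul i a b => simp [MultiBialgebra.counit_mul]
    | one_mul i x => simp
    | mul_one i x => simp
    | mul_assoc i x y z => simp [_root_.mul_assoc]
    | anti_left j x =>
      have h := comp_conv (counit (R := k) (A := TermSpace k I J B)) (m' := LinearMap.mul k k)
        (counit_mul j.1) (TermSpace.anti j) .id
      rw [counit_comp_anti, LinearMap.comp_id, conv_counit_counit] at h
      have h' := LinearMap.congr_fun h x
      rw [LinearMap.comp_apply] at h'
      simp [h']
    | anti_right j x =>
      have h := comp_conv (counit (R := k) (A := TermSpace k I J B)) (m' := LinearMap.mul k k)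
        (counit_mul j.1) .id (TermSpace.anti j)
      rw [counit_comp_anti, LinearMap.comp_id, conv_counit_counit] at h
      have h' := LinearMap.congr_fun h x
      rw [LinearMap.comp_apply] at h'
      simp [h']
  map_mkQ_comul_eq_zero x hx := by
    change projComul k I J B x = 0
    induction hx with
    | zero => simp
    | add _ _ hx hy => simp [hx, hy]
    | smul c _ hx => simp [hx]
    | mul_left i x _ hy => simp [projComul_mul, hy]
    | mul_right i y _ hx => simp [projComul_mul, hx]
    | anti j _ hx => simp [projComul_anti_apply, hx]
    | incl_one =>
      rw [map_sub, sub_eq_zero, projComul_one]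
      simp [projComul, comul_incl, MultiBialgebra.comul_one, -Submodule.mkQ_apply,
        proj_eq .incl_one]
    | incl_mul i a b =>
      rw [map_sub, sub_eq_zero, projComul_mul]
      simp only [projComul, LinearMap.comp_apply, comul_incl, MultiBialgebra.comul_mul,
        ← LinearMap.comp_apply (map (proj k I J B) (proj k I J B)), ← map_comp]
      exact map_map₂ (fun a b => proj_eq (.incl_mul i a b)) (fun a b => proj_eq (.incl_mul i a b))
        _ _
    | one_mul i x =>
      rw [map_sub, sub_eq_zero, projComul_mul, projComul_one, map₂_one_left (one_mul i)]
    | mul_one i x =>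
      rw [map_sub, sub_eq_zero, projComul_mul, projComul_one, map₂_one_right (mul_one i)]
    | mul_assoc i x y z =>
      rw [map_sub, sub_eq_zero]
      simp only [projComul_mul, map₂_assoc (mul_assoc i)]
    -- Since `(π ⊗ π) Δ` is multiplicative, it sends `S_j * id` to `τ (π S_j ⊗ π S_j) Δ * (π ⊗ π)
    -- Δ`, which is trivial because `π S_j` is inverse to `π`.
    | anti_left j x =>
      have h := comp_conv (projComul k I J B) (projComul_mul j.1) (TermSpace.anti j) .id
      rw [LinearMap.comp_id, projComul_anti, projComul, conv_comm_map_comul (one_mul j.1)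
        (mul_one j.1) (mul_assoc j.1) (conv_anti_proj j)] at h
      rw [map_sub, sub_eq_zero, convOne_apply, map_smul, projComul_one]
      exact LinearMap.congr_fun h x
    | anti_right j x =>
      have h := comp_conv (projComul k I J B) (projComul_mul j.1) .id (TermSpace.anti j)
      rw [LinearMap.comp_id, projComul_anti, projComul, conv_map_comul_comm (one_mul j.1)
        (mul_one j.1) (mul_assoc j.1) (conv_proj_anti j)] at h
      rw [map_sub, sub_eq_zero, convOne_apply, map_smul, projComul_one]
      exact LinearMap.congr_fun h x

lemma comul_proj (x : TermSpace k I J B) :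
    comul (R := k) (proj k I J B x) = projComul k I J B x :=
  Quotient.comul_mk _ x

lemma counit_proj (x : TermSpace k I J B) :
    counit (R := k) (proj k I J B x) = counit x :=
  Quotient.counit_mk _ x

noncomputable instance : MultiBialgebra k I (Envelope k I J B) where
  one := proj k I J B (one k I J B)
  mul := mul
  one_mul := one_mul
  mul_one := mul_one
  mul_assoc := mul_assoc
  counit_one := by rw [counit_proj, counit_one]
  comul_one := by rw [comul_proj, projComul_one]
  counit_mul i a b := by
    obtain ⟨x, rfl⟩ := proj_surjective a
    obtain ⟨y, rfl⟩ := proj_surjective b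
    rw [← proj_mul, counit_proj, counit_proj, counit_proj, counit_mul]
  comul_mul i a b := by
    obtain ⟨x, rfl⟩ := proj_surjective a
    obtain ⟨y, rfl⟩ := proj_surjective b
    rw [← proj_mul, comul_proj, comul_proj, comul_proj, projComul_mul]

/-- The projection is a surjective coalgebra map, so precomposing with it reduces both identities to
`conv_anti_proj` and `conv_proj_anti`. -/
lemma isAntipode_anti (j : J) :
    MultiBialgebra.IsAntipode (k := k) (B := Envelope k I J B) j.1 (anti j) := by
  have hp : map (proj k I J B) (proj k I J B) ∘ₗ comul = comul (R := k) ∘ₗ proj k I J B :=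
    LinearMap.ext fun x => (comul_proj x).symm
  have hc : convOne (k := k) (Envelope k I J B) (proj k I J B (one k I J B)) ∘ₗ proj k I J B =
      convOne (k := k) (TermSpace k I J B) (proj k I J B (one k I J B)) := by
    ext1 x
    simp only [LinearMap.comp_apply, convOne_apply, counit_proj]
  apply MultiBialgebra.IsAntipode.of_conv
  · rw [← LinearMap.cancel_right (proj_surjective (k := k) (J := J) (B := B))]
    exact (conv_comp _ hp _ _).trans ((conv_anti_proj j).trans hc.symm)
  · rw [← LinearMap.cancel_right (proj_surjective (k := k) (J := J) (B := B))]
    exact (conv_comp _ hp _ _).trans ((conv_proj_anti j).trans hc.symm)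

instance [IsCocomm k B] : IsCocomm k (Envelope k I J B) where
  comm_comp_comul := by
    rw [← LinearMap.cancel_right (proj_surjective (k := k) (J := J) (B := B))]
    ext1 x
    simp only [LinearMap.comp_apply, comul_proj, projComul, LinearEquiv.coe_coe, ← map_comm,
      comm_comul]

variable (k I J B) in
/-- The canonical map from `B` to its envelope. -/
noncomputable def unit : B →ₗc[k] Envelope k I J B where
  toLinearMap := proj k I J B ∘ₗ incl k I J B
  counit_comp := by
    ext b
    simp only [LinearMap.comp_apply, counit_proj, counit_incl]
  map_comp_comul := by
    ext1 b
    simp only [LinearMap.comp_apply, comul_proj, projComul, map_comp, comul_incl]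

lemma unit_one : unit k I J B (MultiBialgebra.one k I) = MultiBialgebra.one k I :=
  proj_eq .incl_one

lemma unit_mul (i : I) (a b : B) : unit k I J B (MultiBialgebra.mul (k := k) i a b) =
    MultiBialgebra.mul (k := k) i (unit k I J B a) (unit k I J B b) :=
  proj_eq (.incl_mul i a b)

/-! ### The universal property of the envelope. -/

section desc

variable {H : Type*} [AddCommGroup H] [Module k H] [MultiBialgebra k I H] {f : B →ₗc[k] H}
  {S : J → H →ₗ[k] H}

/-- The evaluation of formal expressions at a map from `B` to a Hopf algebra. -/
noncomputable def eval (f : B →ₗc[k] H) (S : J → H →ₗ[k] H) : TermSpace k I J B →ₗ[k] H :=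
  TermSpace.lift f.toLinearMap (MultiBialgebra.one k I) (MultiBialgebra.mul (k := k)) S

lemma eval_incl (b : B) : eval f S (incl k I J B b) = f b := lift_incl ..

lemma eval_one : eval f S (one k I J B) = MultiBialgebra.one k I := lift_one ..

lemma eval_mul (i : I) (x y : TermSpace k I J B) :
    eval f S (TermSpace.mul i x y) =
      MultiBialgebra.mul (k := k) i (eval f S x) (eval f S y) := lift_mul ..

lemma eval_anti (j : J) (x : TermSpace k I J B) :
    eval f S (TermSpace.anti j x) = S j (eval f S x) := lift_anti ..

lemma eval_comp_anti (j : J) :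
    eval (I := I) f S ∘ₗ TermSpace.anti j = S j ∘ₗ eval f S := by
  ext1 x
  rw [LinearMap.comp_apply, LinearMap.comp_apply, eval_anti]

section

variable (hS : ∀ j : J, MultiBialgebra.IsAntipode j.1 (S j))
include hS

lemma counit_comp_eval : counit ∘ₗ eval (I := I) f S = counit (R := k) := by
  refine linearMap_ext (fun b => ?_) ?_ (fun i x y hx hy => ?_) (fun j x hx => ?_)
  · simp [eval_incl]
  · simp [eval_one, MultiBialgebra.counit_one]
  · simp only [LinearMap.comp_apply] at hx hy ⊢
    rw [eval_mul, MultiBialgebra.counit_mul, hx, hy, counit_mul]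
  · simp only [LinearMap.comp_apply] at hx ⊢
    rw [eval_anti, counit_anti, ← LinearMap.comp_apply counit, (hS j).counit_comp, hx]

/-- Both sides obey the same recursion over expressions. On `anti j` this is where
`IsAntipode.map_comul` for the genuine antipodes of `H` is needed. -/
lemma map_eval_comp_comul :
    map (eval (I := I) f S) (eval f S) ∘ₗ comul = comul (R := k) ∘ₗ eval f S := by
  refine linearMap_ext (fun b => ?_) ?_ (fun i x y hx hy => ?_) (fun j x hx => ?_)
  · have h : eval f S ∘ₗ incl k I J B = f.toLinearMap := LinearMap.ext eval_incl
    simp only [LinearMap.comp_apply, eval_incl, comul_incl]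
    rw [← LinearMap.comp_apply (map _ _), ← map_comp, h]
    exact CoalgHomClass.map_comp_comul_apply f b
  · simp [eval_one, comul_one, MultiBialgebra.comul_one]
  · simp only [LinearMap.comp_apply] at hx hy ⊢
    rw [comul_mul, map_map₂ (eval_mul i) (eval_mul i), hx, hy, eval_mul,
      MultiBialgebra.comul_mul]
  · simp only [LinearMap.comp_apply] at hx ⊢
    have hc := LinearMap.congr_fun (hS j).map_comul (eval f S x)
    rw [LinearMap.comp_apply] at hc
    rw [eval_anti, hc, comul_anti, map_comm,
      ← LinearMap.comp_apply (map (eval f S) (eval f S)), ← map_comp, eval_comp_anti, map_comp,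
      LinearMap.comp_apply, hx]
    rfl

variable (hf_one : f (MultiBialgebra.one k I) = MultiBialgebra.one k I)
  (hf_mul : ∀ (i : I) a b, f (MultiBialgebra.mul (k := k) i a b) =
    MultiBialgebra.mul (k := k) i (f a) (f b))
include hf_one hf_mul

lemma eval_eq_zero {x : TermSpace k I J B} (hx : IsRelation x) : eval f S x = 0 := by
  induction hx with
  | zero => simp
  | add _ _ hx hy => simp [hx, hy]
  | smul c _ hx => simp [hx]
  | mul_left i x _ hy => simp [eval_mul, hy]
  | mul_right i y _ hx => simp [eval_mul, hx]
  | anti j _ hx => simp [eval_anti, hx]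
  | incl_one => simp [eval_incl, eval_one, hf_one]
  | incl_mul i a b => simp [eval_incl, eval_mul, hf_mul]
  | one_mul i x => simp [eval_one, eval_mul, MultiBialgebra.one_mul]
  | mul_one i x => simp [eval_one, eval_mul, MultiBialgebra.mul_one]
  | mul_assoc i x y z => simp [eval_mul, MultiBialgebra.mul_assoc]
  -- Evaluation is multiplicative and a coalgebra map, so it carries the formal `S_j * id` to the
  -- convolution `S j * id` of `H` precomposed with evaluation, which is `ε(x) 1`.
  | anti_left j x =>
    have h1 := comp_conv (eval f S) (eval_mul (f := f) (S := S) j.1) (TermSpace.anti j) .id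
    have h2 := conv_comp (m := MultiBialgebra.mul (k := k) j.1) (eval f S)
      (map_eval_comp_comul (f := f) hS) (S j) .id
    rw [LinearMap.comp_id, eval_comp_anti] at h1
    rw [(hS j).conv_left, LinearMap.id_comp, ← h1] at h2
    have h3 := LinearMap.congr_fun h2 x
    have h4 := LinearMap.congr_fun (counit_comp_eval (f := f) hS) x
    simp only [LinearMap.comp_apply, convOne_apply] at h3 h4
    rw [map_sub, ← h3, h4, convOne_apply, map_smul, eval_one, sub_self]
  | anti_right j x =>
    have h1 := comp_conv (eval f S) (eval_mul (f := f) (S := S) j.1) .id (TermSpace.anti j)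
    have h2 := conv_comp (m := MultiBialgebra.mul (k := k) j.1) (eval f S)
      (map_eval_comp_comul (f := f) hS) .id (S j)
    rw [LinearMap.comp_id, eval_comp_anti] at h1
    rw [(hS j).conv_right, LinearMap.id_comp, ← h1] at h2
    have h3 := LinearMap.congr_fun h2 x
    have h4 := LinearMap.congr_fun (counit_comp_eval (f := f) hS) x
    simp only [LinearMap.comp_apply, convOne_apply] at h3 h4
    rw [map_sub, ← h3, h4, convOne_apply, map_smul, eval_one, sub_self]

end

/-- The extension of a map from `B` to a Hopf algebra to the envelope. -/
noncomputable def desc (f : B →ₗc[k] H) (S : J → H →ₗ[k] H)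
    (hS : ∀ j : J, MultiBialgebra.IsAntipode j.1 (S j))
    (hf_one : f (MultiBialgebra.one k I) = MultiBialgebra.one k I)
    (hf_mul : ∀ (i : I) a b, f (MultiBialgebra.mul (k := k) i a b) =
      MultiBialgebra.mul (k := k) i (f a) (f b)) : Envelope k I J B →ₗc[k] H where
  toLinearMap := (relations k I J B).liftQ (eval f S)
    fun _ hx => eval_eq_zero hS hf_one hf_mul hx
  counit_comp := by
    rw [← LinearMap.cancel_right (proj_surjective (k := k) (J := J) (B := B))]
    exact counit_comp_eval hS
  map_comp_comul := by
    rw [← LinearMap.cancel_right (proj_surjective (k := k) (J := J) (B := B))]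
    refine .trans (LinearMap.ext fun x => ?_) (map_eval_comp_comul hS)
    rw [LinearMap.comp_apply, LinearMap.comp_apply, comul_proj, projComul, LinearMap.comp_apply,
      ← LinearMap.comp_apply (map _ _), ← map_comp]
    rfl

end desc

/-- Maps of bialgebras from the envelope to a Hopf algebra are determined by their restriction
to `B`. -/
lemma hom_ext {H : Type*} [AddCommGroup H] [Module k H] [MultiBialgebra k I H]
    (hH : ∀ j ∈ J, ∃ S : H →ₗ[k] H, MultiBialgebra.IsAntipode j S)
    {f g : Envelope k I J B →ₗc[k] H}
    (f_one : f (MultiBialgebra.one k I) = MultiBialgebra.one k I)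
    (f_mul : ∀ (i : I) a b, f (MultiBialgebra.mul (k := k) i a b) =
      MultiBialgebra.mul (k := k) i (f a) (f b))
    (g_one : g (MultiBialgebra.one k I) = MultiBialgebra.one k I)
    (g_mul : ∀ (i : I) a b, g (MultiBialgebra.mul (k := k) i a b) =
      MultiBialgebra.mul (k := k) i (g a) (g b))
    (h : ∀ b, f (unit k I J B b) = g (unit k I J B b)) : f = g := by
  suffices f.toLinearMap ∘ₗ proj k I J B = g.toLinearMap ∘ₗ proj k I J B by
    rw [LinearMap.cancel_right proj_surjective] at this
    exact DFunLike.ext _ _ (LinearMap.congr_fun this)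
  refine linearMap_ext h (f_one.trans g_one.symm) (fun i x y hx hy => ?_) (fun j x hx => ?_)
  · exact (f_mul i _ _).trans ((congr_arg₂ (fun a b => MultiBialgebra.mul (k := k) i a b)
      hx hy).trans (g_mul i _ _).symm)
  -- Both maps intertwine the antipode of the envelope with the same `S`, so agreement at `x` gives
  -- agreement at `anti j x`.
  · obtain ⟨S, hS⟩ := hH j j.2
    exact ((isAntipode_anti j).map_comp hS f f_one (f_mul j.1) _).trans
      ((congr_arg S hx).trans ((isAntipode_anti j).map_comp hS g g_one (g_mul j.1) _).symm)

end Envelope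

end HopfEnvelope

/-! ### Reflections in the category of `I`-bialgebras. -/

namespace MultiBialgCat

variable {k : Type u} [Field k] {I : Type w}

/-- The free `(I, J)`-Hopf algebra on an `I`-bialgebra, as an object of the category of
`I`-bialgebras. -/
noncomputable def envelope (J : Set I) (B : MultiBialgCat.{max u v w} k I) :
    MultiBialgCat.{max u v w} k I where
  carrier := HopfEnvelope.Envelope k I J B

variable (J : Set I) (B : MultiBialgCat.{max u v w} k I)

lemma isHopf_envelope : isHopf k J (envelope.{v} J B) :=
  fun j hj => ⟨_, HopfEnvelope.Envelope.isAntipode_anti ⟨j, hj⟩⟩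

lemma isCocomm_envelope (hB : isCocomm k I B) : isCocomm k I (envelope.{v} J B) :=
  have : Coalgebra.IsCocomm k B := hB
  inferInstanceAs (Coalgebra.IsCocomm k (HopfEnvelope.Envelope k I J B))

/-- The canonical map from an `I`-bialgebra to its envelope. -/
noncomputable def toEnvelope : B ⟶ envelope.{v} J B :=
  Hom.mk (HopfEnvelope.Envelope.unit k I J B) HopfEnvelope.Envelope.unit_one
    HopfEnvelope.Envelope.unit_mul

variable {J B} {H : MultiBialgCat.{max u v w} k I}

lemma exists_toEnvelope_comp_eq (hH : isHopf k J H) (f : B ⟶ H) :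
    ∃ g : envelope.{v} J B ⟶ H, toEnvelope.{v} J B ≫ g = f := by
  choose S hS using hH
  refine ⟨Hom.mk (HopfEnvelope.Envelope.desc f.toCoalgHom (fun j => S j.1 j.2)
    (fun j => hS j.1 j.2) f.map_one f.map_mul) HopfEnvelope.Envelope.eval_one ?_, ?_⟩
  · intro i a b
    obtain ⟨x, rfl⟩ := HopfEnvelope.Envelope.proj_surjective a
    obtain ⟨y, rfl⟩ := HopfEnvelope.Envelope.proj_surjective b
    exact HopfEnvelope.Envelope.eval_mul i x y
  · exact Hom.ext (DFunLike.ext _ _ fun b => HopfEnvelope.Envelope.eval_incl b)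

lemma envelope_hom_ext (hH : isHopf k J H) {f g : envelope.{v} J B ⟶ H}
    (h : toEnvelope.{v} J B ≫ f = toEnvelope.{v} J B ≫ g) : f = g :=
  Hom.ext (HopfEnvelope.Envelope.hom_ext hH f.map_one f.map_mul g.map_one g.map_mul fun b =>
    DFunLike.congr_fun (congr_arg Hom.toCoalgHom h) b)

/-- A full subcategory of Hopf algebras containing the envelopes of all objects of a larger full
subcategory of bialgebras is reflective in the latter. -/
theorem isRightAdjoint_ιOfLE {P P' : ObjectProperty (MultiBialgCat.{max u v w} k I)} (h : P ≤ P')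
    (hP : P ≤ isHopf k J) (henv : ∀ B, P' B → P (envelope.{v} J B)) :
    (ObjectProperty.ιOfLE h).IsRightAdjoint := by
  -- A left adjoint exists once each category of arrows from `A` into the subcategory has an initial
  -- object, here `A` mapping to its envelope.
  have (A : P'.FullSubcategory) :
      Limits.HasInitial (StructuredArrow A (ObjectProperty.ιOfLE h)) := by
    have hex (Y : StructuredArrow A (ObjectProperty.ιOfLE h)) :=
      exists_toEnvelope_comp_eq.{v} (hP _ Y.right.property) Y.hom.hom
    choose g hg using hex
    let X : StructuredArrow A (ObjectProperty.ιOfLE h) :=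
      StructuredArrow.mk (Y := (⟨envelope.{v} J A.obj, henv _ A.property⟩ : P.FullSubcategory))
        (ObjectProperty.homMk (toEnvelope.{v} J A.obj) : A ⟶ ⟨envelope.{v} J A.obj, _⟩)
    refine Limits.IsInitial.hasInitial (X := X) (.ofUniqueHom
      (fun Y => StructuredArrow.homMk (ObjectProperty.homMk (g Y))
        (ObjectProperty.hom_ext _ (hg Y))) fun Y m => ?_)
    refine StructuredArrow.hom_ext _ _ (ObjectProperty.hom_ext _
      (envelope_hom_ext.{v} (hP _ Y.right.property) ?_))
    exact (congr_arg InducedCategory.Hom.hom (StructuredArrow.w m)).trans (hg Y).symm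
  exact isRightAdjointOfStructuredArrowInitials _

end MultiBialgCat

/-- The universe `max u v w` leaves room for the envelope, which consists of combinations over `k`
of expressions labelled by `I`. -/
theorem proposition4p1 (k : Type u) [Field k] (I : Type w) (J' J : Set I) (h : J' ⊆ J) :
    (HalgCat.forget.{max u v w} k h).IsRightAdjoint ∧
      (CocommHalgCat.forget.{max u v w} k h).IsRightAdjoint :=
  ⟨MultiBialgCat.isRightAdjoint_ιOfLE.{v} _ le_rfl
      fun B _ => MultiBialgCat.isHopf_envelope.{v} J B,
    MultiBialgCat.isRightAdjoint_ιOfLE.{v} _ inf_le_left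
      fun B hB => ⟨MultiBialgCat.isHopf_envelope.{v} J B,
        MultiBialgCat.isCocomm_envelope.{v} J B hB.2⟩⟩
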